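/- Let $A_1\in\mathbb R^{n_1\times n_1}$, $L_1\in\mathbb R^{n_1\times q}$, $B_1\in\mathbb R^{n_1\times m}$, $C_1\in\mathbb R^{p\times n_1}$, $A_2\in\mathbb R^{n_2\times n_2}$, $L_2\in\mathbb R^{n_2\times r}$, $\Gamma_1\in\mathbb R^{r\times n_1}$, $\Gamma_2\in\mathbb R^{q\times n_2}$, and suppose that $$A:=\begin{bmatrix}A_1&L_1\Gamma_2\\ L_2\Gamma_1&A_2\end{bmatrix}$$ is stable (all its eigenvalues have negative real part). Consider the hierarchical realization $$\dot{\hat\xi}_1=A_1\hat\xi_1+B_1u_1,\qquad \begin{bmatrix}\dot\xi_1\\ \dot\xi_2\end{bmatrix}=A\begin{bmatrix}\xi_1\\ \xi_2\end{bmatrix}+\begin{bmatrix}0\\ L_2\Gamma_1\end{bmatrix}\hat\xi_1$$ in closed loop with the local static output feedback $u_1=K_1C_1\hat\xi_1$, $K_1\in\mathbb R^{m\times p}$. A linear system $\dot x=Mx$ is called internally stable if $M$ is stable. Then: (a) For every $K_1$, the closed-loop system (with state $(\hat\xi_1,\xi_1,\xi_2)$) is internally stable if and only if the isolated closed loop $\dot{\hat\xi}_1=(A_1+B_1K_1C_1)\hat\xi_1$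 is internally stable. (b) Let $E_1=\begin{bmatrix}I\\0\end{bmatrix}$, $E_2=\begin{bmatrix}0\\I\end{bmatrix}$ (partitioned as $A$) and, for $i\in\{1,2\}$, let $G_i(s)=E_i^{\mathsf T}(sI-A)^{-1}E_2L_2\Gamma_1$, and put $$\alpha_1=\|G_1+I\|_{\mathcal H_\infty},\quad \alpha_2=\|G_2\|_{\mathcal H_\infty},\quad \beta_i(\zeta_0)=\|E_i^{\mathsf T}e^{At}E_1\zeta_0\|_{\mathcal L_2}\quad(\zeta_0\in\mathbb R^{n_1}),$$ where $\|f\|_{\mathcal L_2}$ is the $L^2$-norm on $[0,\infty)$ with respect to the Euclidean norm and $\|G\|_{\mathcal H_\infty}$ is the supremum of the largest singular value of $G(s)$ over $\operatorname{Re}s>0$. These are finite nonnegative numbers, and they do not depend on $K_1$. For every $K_1$ and every $\epsilon_1>0$: if every solution of $\dot{\hat\xi}_1=(A_1+B_1K_1C_1)\hat\xi_1$ with $\|\hat\xi_1(0)\|\le1$ satisfies $\|\hat\xi_1\|_{\mathcal L_2}\le\epsilon_1$, then for all $\zeta_0,\delta_0\in\mathbb R^{n_1}$ with $\|\delta_0\|\le1$,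 the solution of the closed-loop system with $\hat\xi_1(0)=\delta_0-\zeta_0$, $\xi_1(0)=\zeta_0$, $\xi_2(0)=0$ satisfies $$\|\xi_1+\hat\xi_1\|_{\mathcal L_2}\le\alpha_1(1+\|\zeta_0\|)\epsilon_1+\beta_1(\zeta_0),\qquad \|\xi_2\|_{\mathcal L_2}\le\alpha_2(1+\|\zeta_0\|)\epsilon_1+\beta_2(\zeta_0).$$ -/

import Mathlib

open MeasureTheory Matrix
open scoped ENNReal

noncomputable section

/-- The matrix-vector product on Euclidean spaces (vectors carry the Euclidean norm). -/
def matAct {m n : Type*} [Fintype n] (M : Matrix m n ℝ) (v : EuclideanSpace ℝ n) :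
    EuclideanSpace ℝ m :=
  WithLp.toLp 2 (M *ᵥ WithLp.ofLp v)

/-- The stacked vector `[x; y]`. -/
def stack {m n : Type*} (x : EuclideanSpace ℝ m) (y : EuclideanSpace ℝ n) :
    EuclideanSpace ℝ (m ⊕ n) :=
  WithLp.toLp 2 (Sum.elim (WithLp.ofLp x) (WithLp.ofLp y))

/-- The `L²`-norm on `[0, ∞)` of a vector-valued signal; it is `⊤` if the (measurable) signal is
not square-integrable. -/
def l2Norm {n : Type*} [Fintype n] (f : ℝ → EuclideanSpace ℝ n) : ℝ≥0∞ :=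
  eLpNorm f 2 (volume.restrict (Set.Ici 0))

/-- The `H∞`-norm of a matrix-valued function on the complex plane: the supremum of its largest
singular value (the operator norm for the Euclidean norms) over the open right half-plane. -/
def hInfNorm {m n : Type*} [Fintype m] [Fintype n] [DecidableEq n]
    (G : ℂ → Matrix m n ℂ) : ℝ≥0∞ :=
  ⨆ (s : ℂ) (_ : 0 < s.re), ‖LinearMap.toContinuousLinearMap (Matrix.toEuclideanLin (G s))‖ₑ

/-- A real square matrix is stable (Hurwitz) if all its complex eigenvalues have negative real
part; a linear system `ẋ = M x` is internally stable if `M` is stable. -/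
def IsStableMatrix {n : Type*} [Fintype n] [DecidableEq n] (M : Matrix n n ℝ) : Prop :=
  ∀ μ ∈ spectrum ℂ (M.map Complex.ofReal), μ.re < 0

/-- A linear system `ẋ = A x + B u`, `y = C x`. -/
structure StateSpace (n m p : Type*) where
  A : Matrix n n ℝ
  B : Matrix n m ℝ
  C : Matrix p n ℝ

namespace StateSpace

variable {n m p : Type*} [Fintype n] [Fintype m] [Fintype p]

/-- `x` solves `ẋ = A x + B u` on `[0, ∞)` (with the one-sided derivative at `0`). -/
def IsTrajectory (P : StateSpace n m p) (u : ℝ → EuclideanSpace ℝ m)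
    (x : ℝ → EuclideanSpace ℝ n) : Prop :=
  ∀ t : ℝ, 0 ≤ t →
    HasDerivWithinAt x (matAct P.A (x t) + matAct P.B (u t)) (Set.Ici 0) t

/-- `x` is a trajectory of the system in closed loop with the static output feedback `u = K y`. -/
def IsClosedLoopTrajectory (P : StateSpace n m p) (K : Matrix m p ℝ)
    (x : ℝ → EuclideanSpace ℝ n) : Prop :=
  P.IsTrajectory (fun t => matAct K (matAct P.C (x t))) x

/-- The state matrix of the closed loop with the static output feedback `u = K y`. -/
def closedLoopMatrix (P : StateSpace n m p) (K : Matrix m p ℝ) : Matrix n n ℝ :=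
  P.A + P.B * K * P.C

end StateSpace

/-- The data of two interconnected linear systems
`ẋ₁ = A₁ x₁ + L₁ γ₂ + B₁ u₁`, `y₁ = C₁ x₁` and `ẋ₂ = A₂ x₂ + L₂ Γ₁ x₁`, `γ₂ = Γ₂ x₂`. -/
structure InterconnectedSystem (n₁ n₂ m p q r : ℕ) where
  A₁ : Matrix (Fin n₁) (Fin n₁) ℝ
  L₁ : Matrix (Fin n₁) (Fin q) ℝ
  B₁ : Matrix (Fin n₁) (Fin m) ℝ
  C₁ : Matrix (Fin p) (Fin n₁) ℝ
  A₂ : Matrix (Fin n₂) (Fin n₂) ℝ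
  L₂ : Matrix (Fin n₂) (Fin r) ℝ
  Γ₁ : Matrix (Fin r) (Fin n₁) ℝ
  Γ₂ : Matrix (Fin q) (Fin n₂) ℝ

namespace InterconnectedSystem

variable {n₁ n₂ m p q r : ℕ}

/-- The state matrix of the interconnected (preexisting) system. -/
def A (S : InterconnectedSystem n₁ n₂ m p q r) :
    Matrix (Fin n₁ ⊕ Fin n₂) (Fin n₁ ⊕ Fin n₂) ℝ :=
  Matrix.fromBlocks S.A₁ (S.L₁ * S.Γ₂) (S.L₂ * S.Γ₁) S.A₂

/-- The upstream system `dξ̂₁/dt = A₁ ξ̂₁ + B₁ u₁` with output `C₁ ξ̂₁`: the isolated model of the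
first subsystem. -/
def upstream (S : InterconnectedSystem n₁ n₂ m p q r) :
    StateSpace (Fin n₁) (Fin m) (Fin p) where
  A := S.A₁
  B := S.B₁
  C := S.C₁

/-- The hierarchical realization: the cascade, with state `[ξ̂₁; [ξ₁; ξ₂]]`, of the upstream system
`dξ̂₁/dt = A₁ ξ̂₁ + B₁ u₁` and of the downstream system `dξ/dt = A ξ + [0; L₂ Γ₁] ξ̂₁`; its output
is `C₁ ξ̂₁`. -/
def hierarchical (S : InterconnectedSystem n₁ n₂ m p q r) :
    StateSpace (Fin n₁ ⊕ (Fin n₁ ⊕ Fin n₂)) (Fin m) (Fin p) where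
  A := Matrix.fromBlocks S.A₁ 0 (Matrix.fromRows 0 (S.L₂ * S.Γ₁)) S.A
  B := Matrix.fromRows S.B₁ 0
  C := Matrix.fromCols S.C₁ 0

/-- `E₁ = [I; 0]`. -/
def E₁ (R : Type*) [Zero R] [One R] (n₁ n₂ : ℕ) : Matrix (Fin n₁ ⊕ Fin n₂) (Fin n₁) R :=
  Matrix.fromRows 1 0

/-- `E₂ = [0; I]`. -/
def E₂ (R : Type*) [Zero R] [One R] (n₁ n₂ : ℕ) : Matrix (Fin n₁ ⊕ Fin n₂) (Fin n₂) R :=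
  Matrix.fromRows 0 1

/-- `(sI - A)⁻¹ E₂ L₂ Γ₁`, the transfer matrix from `ξ̂₁` to `[ξ₁; ξ₂]`. -/
def transfer (S : InterconnectedSystem n₁ n₂ m p q r) (s : ℂ) :
    Matrix (Fin n₁ ⊕ Fin n₂) (Fin n₁) ℂ :=
  (s • (1 : Matrix (Fin n₁ ⊕ Fin n₂) (Fin n₁ ⊕ Fin n₂) ℂ) - S.A.map Complex.ofReal)⁻¹ *
    E₂ ℂ n₁ n₂ * (S.L₂ * S.Γ₁).map Complex.ofReal

/-- `G₁(s) = E₁ᵀ (sI - A)⁻¹ E₂ L₂ Γ₁`. -/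
def G₁ (S : InterconnectedSystem n₁ n₂ m p q r) (s : ℂ) : Matrix (Fin n₁) (Fin n₁) ℂ :=
  (E₁ ℂ n₁ n₂)ᵀ * S.transfer s

/-- `G₂(s) = E₂ᵀ (sI - A)⁻¹ E₂ L₂ Γ₁`. -/
def G₂ (S : InterconnectedSystem n₁ n₂ m p q r) (s : ℂ) : Matrix (Fin n₂) (Fin n₁) ℂ :=
  (E₂ ℂ n₁ n₂)ᵀ * S.transfer s

/-- `α₁ = ‖G₁ + I‖` in `H∞`. -/
def α₁ (S : InterconnectedSystem n₁ n₂ m p q r) : ℝ≥0∞ := hInfNorm fun s => S.G₁ s + 1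

/-- `α₂ = ‖G₂‖` in `H∞`. -/
def α₂ (S : InterconnectedSystem n₁ n₂ m p q r) : ℝ≥0∞ := hInfNorm S.G₂

/-- `β₁(ζ₀) = ‖E₁ᵀ exp(A t) E₁ ζ₀‖` in `L²`. -/
def β₁ (S : InterconnectedSystem n₁ n₂ m p q r) (ζ₀ : EuclideanSpace ℝ (Fin n₁)) : ℝ≥0∞ :=
  l2Norm fun t => matAct ((E₁ ℝ n₁ n₂)ᵀ * NormedSpace.exp (t • S.A) * E₁ ℝ n₁ n₂) ζ₀

/-- `β₂(ζ₀) = ‖E₂ᵀ exp(A t) E₁ ζ₀‖` in `L²`. -/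
def β₂ (S : InterconnectedSystem n₁ n₂ m p q r) (ζ₀ : EuclideanSpace ℝ (Fin n₁)) : ℝ≥0∞ :=
  l2Norm fun t => matAct ((E₂ ℝ n₁ n₂)ᵀ * NormedSpace.exp (t • S.A) * E₁ ℝ n₁ n₂) ζ₀

/-- The local control performance specification: every trajectory of the isolated closed loop that
starts in the unit ball has `L²`-norm at most `ε₁`. -/
def LocalSpec (S : InterconnectedSystem n₁ n₂ m p q r) (K₁ : Matrix (Fin m) (Fin p) ℝ)
    (ε₁ : ℝ) : Prop :=
  ∀ ξh : ℝ → EuclideanSpace ℝ (Fin n₁), S.upstream.IsClosedLoopTrajectory K₁ ξh →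
    ‖ξh 0‖ ≤ 1 → l2Norm ξh ≤ ENNReal.ofReal ε₁

end InterconnectedSystem

end

/-! The state $\hat\xi_1$ drives $\xi=(\xi_1,\xi_2)$, but nothing flows back, and the feedback uses
$\hat\xi_1$ alone. The closed-loop matrix is therefore block triangular with diagonal blocks
$A_1+B_1K_1C_1$ and the stable $A$, and its spectrum is the union of theirs; this is (a).

For (b), $\xi$ is a trajectory of $\dot\xi=A\xi+E_2L_2\Gamma_1\hat\xi_1$ with $\xi(0)=E_1\zeta_0$.
By superposition each output is a free response, of norm $\beta_i(\zeta_0)$, plus a response from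
rest, of norm at most $\alpha_i\|\hat\xi_1\|_{\mathcal L_2}$. Since $\|\hat\xi_1(0)\|\le
1+\|\zeta_0\|$, homogeneity of the local specification bounds $\|\hat\xi_1\|_{\mathcal L_2}$ by
$(1+\|\zeta_0\|)\epsilon_1$.

The analytic core is the gain bound `eLpNorm_output_le`. On a line $\operatorname{Re}s=\sigma>0$ the
Laplace transforms satisfy $\hat y=G\hat u$; Plancherel turns the pointwise bound on $G$ into an
$L^2$ bound for signals weighted by $e^{-\sigma t}$, and Fatou's lemma lets $\sigma\to0$. Finiteness
of $\alpha_i$ and $\beta_i$ rests on $\|e^{At}\|\le Ce^{-ct}$, obtained in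
`ContinuousLinearMap.exists_norm_exp_le`. Real signals are complexified isometrically to use these
tools. -/

/-! ### Plancherel's theorem for the Fourier integral -/

section Plancherel

open FourierTransform

variable {F : Type*} [NormedAddCommGroup F] [InnerProductSpace ℂ F] [CompleteSpace F]

/-- On `L¹ ∩ L²` the `L²`-Fourier transform is given by the Fourier integral. -/
theorem MeasureTheory.MemLp.coeFn_fourier_toLp {f : ℝ → F} (h1 : Integrable f) (h2 : MemLp f 2) :
    ((𝓕 (h2.toLp f) : Lp F 2 (volume : Measure ℝ)) : ℝ → F) =ᵐ[volume] 𝓕 f := by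
  have hcont : Continuous (𝓕 f) :=
    VectorFourier.fourierIntegral_continuous Real.continuous_fourierChar
      (by exact continuous_inner) h1
  -- Both sides are tested against smooth compactly supported `g`. The `L²` transform obeys `⟨𝓕 f,
  -- φ⟩ = ⟨f, 𝓕 φ⟩` as a tempered distribution, and the Fourier integral obeys the same identity by
  -- Fubini.
  refine ae_eq_of_integral_contDiff_smul_eq
    ((Lp.memLp _).locallyIntegrable (by norm_num)) hcont.locallyIntegrable fun g hg hgc => ?_
  have hgs : HasCompactSupport (fun x => (g x : ℂ)) := hgc.comp_left Complex.ofReal_zero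
  have hgd : ContDiff ℝ (↑(⊤ : ℕ∞)) (fun x => (g x : ℂ)) := Complex.ofRealCLM.contDiff.comp hg
  let φ : SchwartzMap ℝ ℂ := hgs.toSchwartzMap hgd
  have hφ : ∀ x, φ x = (g x : ℂ) := fun x => rfl
  have key := congrArg (fun T : TemperedDistribution ℝ F => T φ)
    (Lp.fourier_toTemperedDistribution_eq (h2.toLp f))
  simp only [TemperedDistribution.fourier_apply, Lp.toTemperedDistribution_apply] at key
  have e1 : ∫ x, (𝓕 φ) x • (h2.toLp f : ℝ → F) x = ∫ x, (𝓕 φ) x • f x :=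
    integral_congr_ae (by filter_upwards [h2.coeFn_toLp] with x hx; rw [hx])
  have e2 : ∫ x, (𝓕 φ) x • f x = ∫ x, φ x • 𝓕 f x := by
    rw [SchwartzMap.fourier_coe]
    have := VectorFourier.integral_fourierIntegral_smul_eq_flip (L := innerₗ ℝ)
      Real.continuous_fourierChar (by exact continuous_inner) (φ.integrable (μ := volume)) h1
    rw [flip_innerₗ] at this
    exact this
  rw [e1, e2] at key
  simpa [hφ] using key.symm

/-- **Plancherel's theorem** on `L¹ ∩ L²`. -/
theorem MeasureTheory.eLpNorm_fourier_eq {f : ℝ → F} (h1 : Integrable f) (h2 : MemLp f 2) :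
    eLpNorm (𝓕 f) 2 volume = eLpNorm f 2 volume := by
  rw [← eLpNorm_congr_ae (MemLp.coeFn_fourier_toLp h1 h2), ← eLpNorm_congr_ae h2.coeFn_toLp,
    ← Lp.enorm_def, ← Lp.enorm_def, ← ofReal_norm, ← ofReal_norm,
    Lp.norm_fourier_eq]

end Plancherel

/-! ### Exponential decay from the spectrum -/

section ExponentialStability

variable {E : Type*} [NormedAddCommGroup E] [NormedSpace ℂ E] [FiniteDimensional ℂ E]

omit [FiniteDimensional ℂ E] in
theorem ContinuousLinearMap.exp_apply_of_eigenvector [CompleteSpace E] {T : E →L[ℂ] E} {μ : ℂ}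
    {v : E} (h : T v = μ • v) : NormedSpace.exp T v = Complex.exp μ • v := by
  have hp : ∀ k : ℕ, (T ^ k) v = μ ^ k • v := by
    intro k
    induction k with
    | zero => simp
    | succ k ih =>
      rw [pow_succ', mul_apply_eq_comp, ih, map_smul, h, smul_smul, ← pow_succ]
  have h1 := (NormedSpace.exp_series_hasSum_exp' (𝕂 := ℂ) T).mapL (ContinuousLinearMap.apply ℂ E v)
  have h2 := (NormedSpace.exp_series_hasSum_exp' (𝕂 := ℂ) μ).smul_const v
  rw [Complex.exp_eq_exp_ℂ]
  refine h1.unique ?_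
  convert! h2 using 2 with k
  simp [hp, smul_smul]

/-- Every element of the spectrum of `exp T` is the exponential of an element of the spectrum
of `T`. -/
theorem ContinuousLinearMap.spectrum_exp_subset (T : E →L[ℂ] E) :
    spectrum ℂ (NormedSpace.exp T) ⊆ Complex.exp '' spectrum ℂ T := by
  have : CompleteSpace E := FiniteDimensional.complete ℂ E
  intro z hz
  rw [ContinuousLinearMap.spectrum_eq] at hz
  have hev := Module.End.hasEigenvalue_iff_mem_spectrum.2 hz
  have hcomm : Commute (NormedSpace.exp T : E →L[ℂ] E).toLinearMap T.toLinearMap := by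
    have h := ((Commute.refl T).exp_left : Commute (NormedSpace.exp T) T)
    ext v
    exact congrArg (fun f : E →L[ℂ] E => f v) h.eq
  -- `T` commutes with `exp T`, so it preserves the eigenspace of `exp T` at `z`. An eigenvector of
  -- `T` inside that space is common to both operators.
  have hmaps : Set.MapsTo T.toLinearMap
      (Module.End.eigenspace (NormedSpace.exp T : E →L[ℂ] E).toLinearMap z)
      (Module.End.eigenspace (NormedSpace.exp T : E →L[ℂ] E).toLinearMap z) :=
    Module.End.mapsTo_genEigenspace_of_comm hcomm z 1
  have hnt : Nontrivial (Module.End.eigenspace (NormedSpace.exp T : E →L[ℂ] E).toLinearMap z) :=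
    Submodule.nontrivial_iff_ne_bot.2 hev
  obtain ⟨μ, hμ⟩ := Module.End.exists_eigenvalue (T.toLinearMap.restrict hmaps)
  obtain ⟨⟨v, hvz⟩, hv⟩ := hμ.exists_hasEigenvector
  have hv0 : v ≠ 0 := fun h => hv.2 (Subtype.ext h)
  have hTv : T v = μ • v := congrArg Subtype.val hv.apply_eq_smul
  refine ⟨μ, ?_, ?_⟩
  · rw [ContinuousLinearMap.spectrum_eq]
    exact (Module.End.hasEigenvalue_of_hasEigenvector
      ⟨Module.End.mem_eigenspace_iff.2 hTv, hv0⟩).mem_spectrum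
  · have h1 : NormedSpace.exp T v = z • v := Module.End.mem_eigenspace_iff.1 hvz
    rw [exp_apply_of_eigenvector hTv] at h1
    exact smul_left_injective ℂ hv0 h1

/-- The spectrum of `exp T` lies in the open unit disc, so Gelfand's formula gives `N` with `‖(exp
T)^N‖ < 1`. Writing `t = k N + s` with `s` in the compact interval `[0, N]`, geometric decay in `k`
becomes exponential decay in `t`. -/
theorem ContinuousLinearMap.exists_norm_exp_le [CompleteSpace E] {T : E →L[ℂ] E}
    (hT : ∀ μ ∈ spectrum ℂ T, μ.re < 0) :
    ∃ C c : ℝ, 0 < C ∧ 0 < c ∧ ∀ t : ℝ, 0 ≤ t →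
      ‖NormedSpace.exp ((t : ℂ) • T)‖ ≤ C * Real.exp (-c * t) := by
  rcases subsingleton_or_nontrivial E with hE | hE
  · refine ⟨1, 1, one_pos, one_pos, fun t _ => ?_⟩
    rw [Subsingleton.elim (NormedSpace.exp ((t : ℂ) • T)) 0, norm_zero]
    positivity
  have hrad : spectralRadius ℂ (NormedSpace.exp T) < ((1 : NNReal) : ℝ≥0∞) := by
    refine spectrum.spectralRadius_lt_of_forall_lt _ fun z hz => ?_
    obtain ⟨μ, hμ, rfl⟩ := spectrum_exp_subset T hz
    rw [← NNReal.coe_lt_coe, coe_nnnorm, Complex.norm_exp, NNReal.coe_one, Real.exp_lt_one_iff]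
    exact hT μ hμ
  obtain ⟨N, hN, hN0⟩ := (((spectrum.pow_nnnorm_pow_one_div_tendsto_nhds_spectralRadius
    (NormedSpace.exp T)).eventually_lt_const hrad).and (Filter.eventually_gt_atTop 0)).exists
  have hNpos : (0 : ℝ) < N := by exact_mod_cast hN0
  have hlt : ‖NormedSpace.exp T ^ N‖ < 1 := by
    by_contra! hge
    refine absurd hN (not_lt.2 ?_)
    have : (1 : ℝ≥0∞) ≤ (‖NormedSpace.exp T ^ N‖₊ : ℝ≥0∞) := by exact_mod_cast hge
    calc ((1 : NNReal) : ℝ≥0∞) = 1 ^ (1 / (N : ℝ)) := by simp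
      _ ≤ _ := ENNReal.rpow_le_rpow this (by positivity)
  -- The maximum with `1/2` keeps `ρ` positive, so that its logarithm can serve as a rate.
  set ρ := max ‖NormedSpace.exp T ^ N‖ (1 / 2) with hρ
  have hρ1 : ρ < 1 := max_lt hlt (by norm_num)
  have hρ0 : 0 < ρ := lt_of_lt_of_le (by norm_num) (le_max_right _ _)
  have hlog : Real.log ρ < 0 := Real.log_neg hρ0 hρ1
  let _ : NormedAlgebra ℚ (E →L[ℂ] E) := NormedAlgebra.restrictScalars ℚ ℂ _
  have hcont : Continuous fun s : ℝ => NormedSpace.exp ((s : ℂ) • T) :=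
    NormedSpace.exp_continuous.comp (Complex.continuous_ofReal.smul continuous_const)
  obtain ⟨D, hD⟩ := isCompact_Icc.exists_bound_of_continuousOn
    (s := Set.Icc (0 : ℝ) N) hcont.continuousOn
  have hD0 : 0 ≤ D := (norm_nonneg _).trans (hD 0 ⟨le_rfl, hNpos.le⟩)
  -- The factor `ρ⁻¹` pays for rounding: `k > t / N - 1` gives `ρ ^ k ≤ ρ ^ (t / N - 1)`. `D + 1`
  -- makes the constant positive.
  refine ⟨ρ⁻¹ * (D + 1), -Real.log ρ / N, by positivity,
    div_pos (neg_pos.2 hlog) hNpos, fun t ht => ?_⟩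
  set k := ⌊t / N⌋₊ with hk
  have hk1 : (k : ℝ) ≤ t / N := Nat.floor_le (by positivity)
  have hk2 : t / N < k + 1 := Nat.lt_floor_add_one _
  have hs0 : 0 ≤ t - k * N := sub_nonneg.2 ((le_div_iff₀ hNpos).1 hk1)
  have hsN : t - k * N ≤ N := by
    have := (div_lt_iff₀ hNpos).1 hk2
    linarith
  have hsplit : NormedSpace.exp ((t : ℂ) • T) =
      (NormedSpace.exp T ^ N) ^ k * NormedSpace.exp (((t - k * N : ℝ) : ℂ) • T) := by
    rw [← pow_mul, ← NormedSpace.exp_nsmul, ← NormedSpace.exp_add_of_commute]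
    · congr 1
      rw [← Nat.cast_smul_eq_nsmul ℂ, ← add_smul]
      congr 1
      push_cast
      ring
    · exact ((Commute.refl T).smul_left _).smul_right _
  have h1 : ‖(NormedSpace.exp T ^ N) ^ k‖ ≤ ρ ^ k :=
    (norm_pow_le _ _).trans (pow_le_pow_left₀ (norm_nonneg _) (le_max_left _ _) _)
  have h2 : ‖NormedSpace.exp (((t - k * N : ℝ) : ℂ) • T)‖ ≤ D + 1 :=
    (hD _ ⟨hs0, hsN⟩).trans (by linarith)
  have h3 : ρ ^ k ≤ ρ⁻¹ * Real.exp (-(-Real.log ρ / N) * t) := by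
    rw [← Real.exp_log (pow_pos hρ0 k), ← Real.exp_log (inv_pos.2 hρ0), ← Real.exp_add,
      Real.log_pow, Real.log_inv]
    refine Real.exp_le_exp.2 ?_
    have : -(-Real.log ρ / N) * t = Real.log ρ * (t / N) := by ring
    rw [this]
    nlinarith
  calc _ ≤ ‖(NormedSpace.exp T ^ N) ^ k‖ * ‖NormedSpace.exp (((t - k * N : ℝ) : ℂ) • T)‖ := by
        rw [hsplit]; exact norm_mul_le _ _
    _ ≤ (ρ⁻¹ * Real.exp (-(-Real.log ρ / N) * t)) * (D + 1) :=
        mul_le_mul (h1.trans h3) h2 (norm_nonneg _) (by positivity)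
    _ = _ := by ring

end ExponentialStability

/-! ### Linear equations with forcing and their Laplace transforms -/

section Laplace

variable {E : Type*} [NormedAddCommGroup E] [NormedSpace ℂ E] [CompleteSpace E]

theorem ContinuousLinearMap.hasDerivAt_exp_ofReal_smul (T : E →L[ℂ] E) (t : ℝ) :
    HasDerivAt (fun t : ℝ => NormedSpace.exp ((t : ℂ) • T))
      (NormedSpace.exp ((t : ℂ) • T) * T) t := by
  simpa [Function.comp_def] using
    (hasDerivAt_exp_smul_const T (t : ℂ)).scomp t Complex.ofRealCLM.hasDerivAt

omit [CompleteSpace E] in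
theorem HasDerivAt.complex_clm_apply {F : Type*} [NormedAddCommGroup F] [NormedSpace ℂ F]
    {S : ℝ → E →L[ℂ] F} {S' : E →L[ℂ] F} {x : ℝ → E} {x' : E} {t : ℝ} (hS : HasDerivAt S S' t)
    (hx : HasDerivAt x x' t) : HasDerivAt (fun t => S t (x t)) (S' (x t) + S t x') t :=
  (((ContinuousLinearMap.restrictScalarsL ℂ E F ℝ ℝ).hasFDerivAt.comp_hasDerivAt t hS).clm_apply
    hx :)

theorem integrableOn_Ioi_of_norm_le_exp {F : Type*} [NormedAddCommGroup F] {f : ℝ → F}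
    (hf : ContinuousOn f (Set.Ici 0)) {D c : ℝ} (hc : 0 < c)
    (hb : ∀ t, 0 ≤ t → ‖f t‖ ≤ D * Real.exp (-c * t)) : IntegrableOn f (Set.Ioi 0) := by
  refine Integrable.mono' ((exp_neg_integrableOn_Ioi 0 hc).const_mul D)
    ((hf.mono Set.Ioi_subset_Ici_self).aestronglyMeasurable measurableSet_Ioi) ?_
  exact (ae_restrict_mem measurableSet_Ioi).mono fun t ht => hb t (le_of_lt ht)

theorem memLp_two_Ici_of_norm_le_exp {F : Type*} [NormedAddCommGroup F] {f : ℝ → F}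
    (hf : ContinuousOn f (Set.Ici 0)) {D c : ℝ} (hc : 0 < c)
    (hb : ∀ t, 0 ≤ t → ‖f t‖ ≤ D * Real.exp (-c * t)) :
    MemLp f 2 (volume.restrict (Set.Ici 0)) := by
  refine (memLp_two_iff_integrable_sq_norm (hf.aestronglyMeasurable measurableSet_Ici)).2 ?_
  change IntegrableOn _ _ volume
  rw [integrableOn_Ici_iff_integrableOn_Ioi]
  refine integrableOn_Ioi_of_norm_le_exp (hf.norm.pow 2) (D := D ^ 2) (mul_pos two_pos hc)
    fun t ht => ?_
  rw [Real.norm_of_nonneg (by positivity)]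
  calc ‖f t‖ ^ 2 ≤ (D * Real.exp (-c * t)) ^ 2 := by gcongr; exact hb t ht
    _ = _ := by rw [mul_pow, ← Real.exp_nat_mul]; congr 2; push_cast; ring

theorem tendsto_zero_of_norm_le_exp {F : Type*} [NormedAddCommGroup F] {f : ℝ → F} {D c : ℝ}
    (hc : 0 < c) (hb : ∀ t, 0 ≤ t → ‖f t‖ ≤ D * Real.exp (-c * t)) :
    Filter.Tendsto f Filter.atTop (nhds 0) := by
  refine squeeze_zero_norm' ((Filter.eventually_ge_atTop 0).mono hb) ?_
  have h : Filter.Tendsto (fun t : ℝ => Real.exp (-c * t)) Filter.atTop (nhds 0) :=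
    Real.tendsto_exp_atBot.comp (Filter.tendsto_id.const_mul_atTop_of_neg (neg_lt_zero.2 hc))
  simpa using h.const_mul D

/-- A bound from the variation of constants formula. -/
theorem norm_le_of_hasDerivWithinAt_linear {T : E →L[ℂ] E} {C : ℝ}
    (hC : ∀ t : ℝ, 0 ≤ t → ‖NormedSpace.exp ((t : ℂ) • T)‖ ≤ C) {x w : ℝ → E}
    (hw : ContinuousOn w (Set.Ici 0)) (hx0 : x 0 = 0)
    (hx : ∀ t, 0 ≤ t → HasDerivWithinAt x (T (x t) + w t) (Set.Ici 0) t) {t : ℝ} (ht : 0 ≤ t) :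
    ‖x t‖ ≤ ∫ τ in (0 : ℝ)..t, C * ‖w τ‖ := by
  -- In the derivative of `S τ (x τ)` the terms with `T` cancel and only `S τ (w τ)` is left;
  -- integrating over `[0, t]` gives the formula.
  let S : ℝ → (E →L[ℂ] E) := fun τ => NormedSpace.exp (((t - τ : ℝ) : ℂ) • T)
  have hS : ∀ τ, HasDerivAt S (-(S τ * T)) τ := fun τ => by
    have h := (T.hasDerivAt_exp_ofReal_smul (t - τ)).scomp τ ((hasDerivAt_id τ).const_sub t)
    rwa [neg_one_smul] at h
  have hxc : ContinuousOn x (Set.Ici 0) := fun τ hτ => (hx τ hτ).continuousWithinAt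
  have hSc : Continuous S := continuous_iff_continuousAt.2 fun τ => (hS τ).continuousAt
  have hsub : Set.Icc 0 t ⊆ Set.Ici 0 := Set.Icc_subset_Ici_self
  have hderiv : ∀ τ ∈ Set.Ioo 0 t, HasDerivAt (fun τ => S τ (x τ)) (S τ (w τ)) τ := by
    intro τ hτ
    have h1 : HasDerivAt x (T (x τ) + w τ) τ := (hx τ hτ.1.le).hasDerivAt (Ici_mem_nhds hτ.1)
    convert (hS τ).complex_clm_apply h1 using 1
    simp
  have hwc : ContinuousOn (fun τ => S τ (w τ)) (Set.Icc 0 t) :=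
    hSc.continuousOn.clm_apply (hw.mono hsub)
  have hint := intervalIntegral.integral_eq_sub_of_hasDerivAt_of_le ht
    (hSc.continuousOn.clm_apply (hxc.mono hsub)) hderiv (hwc.intervalIntegrable_of_Icc ht)
  have hSt : S t = 1 := by simp [S]
  rw [hSt, hx0, map_zero, sub_zero, one_apply_eq_self] at hint
  rw [← hint]
  refine intervalIntegral.norm_integral_le_of_norm_le ht (ae_of_all _ fun τ hτ => ?_)
    (((hw.mono hsub).norm.const_smul C).intervalIntegrable_of_Icc ht)
  exact (ContinuousLinearMap.le_opNorm _ _).trans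
    (mul_le_mul_of_nonneg_right (hC _ (sub_nonneg.2 hτ.2)) (norm_nonneg _))

/-- Since `‖w‖ ≤ 1 + ‖w‖²`, variation of constants gives linear growth, `‖x t‖ ≤ C (t + ‖w‖₂²)`.
Growth below every exponential is enough for the Laplace integral to converge on the whole open
right half-plane. -/
theorem exists_norm_le_exp_of_hasDerivWithinAt_linear {T : E →L[ℂ] E} {C : ℝ}
    (hC : ∀ t : ℝ, 0 ≤ t → ‖NormedSpace.exp ((t : ℂ) • T)‖ ≤ C) {x w : ℝ → E}
    (hw : ContinuousOn w (Set.Ici 0)) (hw2 : MemLp w 2 (volume.restrict (Set.Ici 0)))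
    (hx0 : x 0 = 0)
    (hx : ∀ t, 0 ≤ t → HasDerivWithinAt x (T (x t) + w t) (Set.Ici 0) t) {ρ : ℝ} (hρ : 0 < ρ) :
    ∃ D, ∀ t, 0 ≤ t → ‖x t‖ ≤ D * Real.exp (ρ * t) := by
  have hC0 : 0 ≤ C := (norm_nonneg _).trans (hC 0 le_rfl)
  have hsq : IntegrableOn (fun τ => ‖w τ‖ ^ 2) (Set.Ici 0) volume :=
    hw2.integrable_norm_pow two_ne_zero
  set K := ∫ τ in Set.Ici 0, ‖w τ‖ ^ 2 with hK
  have hK0 : 0 ≤ K := integral_nonneg fun _ => by positivity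
  refine ⟨C * (ρ⁻¹ + K), fun t ht => (norm_le_of_hasDerivWithinAt_linear hC hw hx0 hx ht).trans ?_⟩
  have hsub : Set.Icc 0 t ⊆ Set.Ici 0 := Set.Icc_subset_Ici_self
  have hwi : IntervalIntegrable (fun τ => ‖w τ‖) volume 0 t :=
    (hw.mono hsub).norm.intervalIntegrable_of_Icc ht
  have hwi2 : IntervalIntegrable (fun τ => ‖w τ‖ ^ 2) volume 0 t :=
    ((hw.mono hsub).norm.pow 2).intervalIntegrable_of_Icc ht
  have h1 : ∫ τ in (0 : ℝ)..t, ‖w τ‖ ≤ t + K := by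
    calc ∫ τ in (0 : ℝ)..t, ‖w τ‖ ≤ ∫ τ in (0 : ℝ)..t, (1 + ‖w τ‖ ^ 2) :=
          intervalIntegral.integral_mono_on ht hwi (intervalIntegrable_const.add hwi2)
            fun τ _ => by nlinarith [sq_nonneg (‖w τ‖ - 1)]
      _ = t + ∫ τ in (0 : ℝ)..t, ‖w τ‖ ^ 2 := by
          rw [intervalIntegral.integral_add intervalIntegrable_const hwi2]; simp
      _ ≤ t + K := by
          gcongr
          rw [intervalIntegral.integral_of_le ht]
          exact setIntegral_mono_set hsq (ae_of_all _ fun _ => by positivity)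
            (Set.Ioc_subset_Icc_self.trans hsub).eventuallyLE
  have h2 : 1 ≤ Real.exp (ρ * t) := Real.one_le_exp (by positivity)
  have h3 : t ≤ ρ⁻¹ * Real.exp (ρ * t) := by
    rw [← div_eq_inv_mul, le_div_iff₀ hρ]
    linarith [Real.add_one_le_exp (ρ * t), mul_comm t ρ]
  rw [intervalIntegral.integral_const_mul, mul_assoc]
  refine mul_le_mul_of_nonneg_left ?_ hC0
  nlinarith [mul_le_mul_of_nonneg_left h2 hK0]

theorem norm_cexp_neg_mul_ofReal (s : ℂ) (t : ℝ) :
    ‖Complex.exp (-s * t)‖ = Real.exp (-s.re * t) := by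
  simp [Complex.norm_exp]

/-- The Laplace transform of a solution of `ẋ = T x + w`, `x 0 = 0`. -/
theorem laplace_of_hasDerivWithinAt_linear {T : E →L[ℂ] E} {x w : ℝ → E} {s : ℂ}
    (hx0 : x 0 = 0)
    (hx : ∀ t, 0 ≤ t → HasDerivWithinAt x (T (x t) + w t) (Set.Ici 0) t)
    (hxi : IntegrableOn (fun t : ℝ => Complex.exp (-s * t) • x t) (Set.Ioi 0))
    (hwi : IntegrableOn (fun t : ℝ => Complex.exp (-s * t) • w t) (Set.Ioi 0))
    (hlim : Filter.Tendsto (fun t : ℝ => Complex.exp (-s * t) • x t) Filter.atTop (nhds 0)) :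
    s • (∫ t in Set.Ioi (0 : ℝ), Complex.exp (-s * t) • x t) -
      T (∫ t in Set.Ioi (0 : ℝ), Complex.exp (-s * t) • x t) =
      ∫ t in Set.Ioi (0 : ℝ), Complex.exp (-s * t) • w t := by
  have he : ∀ t : ℝ, HasDerivAt (fun t : ℝ => Complex.exp (-s * t)) (-s * Complex.exp (-s * t)) t := by
    intro t
    have := ((Complex.ofRealCLM.hasDerivAt (x := t)).const_mul (-s)).cexp
    simpa [mul_comm] using this
  have hTi := T.integrable_comp hxi
  have hsi : Integrable (fun t : ℝ => s • (Complex.exp (-s * t) • x t))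
    (volume.restrict (Set.Ioi 0)) := hxi.smul s
  have hTsi : Integrable (fun t : ℝ => T (Complex.exp (-s * t) • x t) -
    s • (Complex.exp (-s * t) • x t)) (volume.restrict (Set.Ioi 0)) := hTi.sub hsi
  have hder := integral_Ioi_of_hasDerivAt_of_tendsto
    (f := fun t : ℝ => Complex.exp (-s * t) • x t) (a := 0)
    (f' := fun t : ℝ => T (Complex.exp (-s * t) • x t) - s • (Complex.exp (-s * t) • x t) +
      Complex.exp (-s * t) • w t)
    ((he 0).continuousAt.continuousWithinAt.smul (hx 0 le_rfl).continuousWithinAt)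
    (fun t ht => by
      have h1 : HasDerivAt x (T (x t) + w t) t :=
        (hx t (le_of_lt ht)).hasDerivAt (Ici_mem_nhds ht)
      refine ((he t).smul h1).congr_deriv ?_
      rw [map_smul, smul_add, mul_smul, neg_smul]
      abel)
    (hTsi.add hwi) hlim
  rw [integral_add hTsi hwi, integral_sub hTi hsi, integral_smul,
    T.integral_comp_comm hxi, hx0, smul_zero, sub_zero] at hder
  rw [← sub_eq_zero, ← neg_eq_zero, ← hder]
  abel

end Laplace

/-! ### The `H∞` bound on the `L²`-gain -/

section HInfinity

open FourierTransform

/-- The Laplace transform on the line `Re s = σ` is a Fourier transform, which opens the way to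
Plancherel. -/
theorem fourier_indicator_Ici_cexp_smul {F : Type*} [NormedAddCommGroup F] [NormedSpace ℂ F]
    (σ ω : ℝ) (f : ℝ → F) :
    𝓕 ((Set.Ici 0).indicator fun t : ℝ => Complex.exp (-(σ : ℂ) * t) • f t) ω =
      ∫ t in Set.Ioi (0 : ℝ), Complex.exp (-(σ + 2 * Real.pi * ω * Complex.I) * t) • f t := by
  rw [Real.fourier_eq', ← integral_Ici_eq_integral_Ioi, ← integral_indicator measurableSet_Ici]
  congr 1 with t
  by_cases ht : t ∈ Set.Ici (0 : ℝ)
  · simp only [Set.indicator_of_mem ht, smul_smul, ← Complex.exp_add]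
    congr 2
    simp
    ring
  · simp [Set.indicator_of_notMem ht]

variable {E U Y : Type*} [NormedAddCommGroup E] [NormedSpace ℂ E] [CompleteSpace E]
  [NormedAddCommGroup U] [InnerProductSpace ℂ U] [CompleteSpace U]
  [NormedAddCommGroup Y] [InnerProductSpace ℂ Y] [CompleteSpace Y]

theorem eLpNorm_le_of_norm_laplace_le {y : ℝ → Y} {u : ℝ → U} {σ α : ℝ}
    (hyi : IntegrableOn (fun t : ℝ => Complex.exp (-(σ : ℂ) * t) • y t) (Set.Ioi 0))
    (hy2 : MemLp (fun t : ℝ => Complex.exp (-(σ : ℂ) * t) • y t) 2 (volume.restrict (Set.Ici 0)))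
    (hui : IntegrableOn (fun t : ℝ => Complex.exp (-(σ : ℂ) * t) • u t) (Set.Ioi 0))
    (hu2 : MemLp (fun t : ℝ => Complex.exp (-(σ : ℂ) * t) • u t) 2 (volume.restrict (Set.Ici 0)))
    (h : ∀ ω : ℝ,
      ‖∫ t in Set.Ioi (0 : ℝ), Complex.exp (-(σ + 2 * Real.pi * ω * Complex.I) * t) • y t‖ ≤
      α * ‖∫ t in Set.Ioi (0 : ℝ), Complex.exp (-(σ + 2 * Real.pi * ω * Complex.I) * t) • u t‖) :
    eLpNorm (fun t : ℝ => Complex.exp (-(σ : ℂ) * t) • y t) 2 (volume.restrict (Set.Ici 0)) ≤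
      ENNReal.ofReal α *
        eLpNorm (fun t : ℝ => Complex.exp (-(σ : ℂ) * t) • u t) 2
          (volume.restrict (Set.Ici 0)) := by
  rw [← integrableOn_Ici_iff_integrableOn_Ioi,
    ← integrable_indicator_iff measurableSet_Ici] at hyi hui
  rw [← memLp_indicator_iff_restrict measurableSet_Ici] at hy2 hu2
  rw [← eLpNorm_indicator_eq_eLpNorm_restrict measurableSet_Ici,
    ← eLpNorm_indicator_eq_eLpNorm_restrict measurableSet_Ici, ← eLpNorm_fourier_eq hyi hy2,
    ← eLpNorm_fourier_eq hui hu2]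
  refine eLpNorm_le_mul_eLpNorm_of_ae_le_mul (ae_of_all _ fun ω => ?_) 2
  rw [fourier_indicator_Ici_cexp_smul, fourier_indicator_Ici_cexp_smul]
  exact h ω

/-- The `L²`-gain of a stable linear system started at rest is at most the `H∞`-norm of its
transfer function. -/
theorem eLpNorm_output_le {T : E →L[ℂ] E} {B : U →L[ℂ] E} {G : E →L[ℂ] Y} {H : U →L[ℂ] Y} {C α : ℝ}
    (hC : ∀ t : ℝ, 0 ≤ t → ‖NormedSpace.exp ((t : ℂ) • T)‖ ≤ C)
    (hα : ∀ s : ℂ, 0 < s.re → ∀ X V, s • X - T X = B V → ‖G X + H V‖ ≤ α * ‖V‖)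
    {x : ℝ → E} {u : ℝ → U} (hu : ContinuousOn u (Set.Ici 0))
    (hu2 : MemLp u 2 (volume.restrict (Set.Ici 0))) (hx0 : x 0 = 0)
    (hx : ∀ t, 0 ≤ t → HasDerivWithinAt x (T (x t) + B (u t)) (Set.Ici 0) t) :
    eLpNorm (fun t => G (x t) + H (u t)) 2 (volume.restrict (Set.Ici 0)) ≤
      ENNReal.ofReal α * eLpNorm u 2 (volume.restrict (Set.Ici 0)) := by
  have hexp : ∀ s : ℂ, Continuous fun t : ℝ => Complex.exp (-s * t) := fun s =>
    Complex.continuous_exp.comp (continuous_const.mul Complex.continuous_ofReal)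
  have hxc : ContinuousOn x (Set.Ici 0) := fun t ht => (hx t ht).continuousWithinAt
  have hBu2 : MemLp (fun t => B (u t)) 2 (volume.restrict (Set.Ici 0)) := B.comp_memLp' hu2
  have hsq : IntegrableOn (fun τ => ‖u τ‖ ^ 2) (Set.Ioi 0) volume :=
    (integrableOn_Ici_iff_integrableOn_Ioi).1 (hu2.integrable_norm_pow two_ne_zero)
  -- With `a = exp (-s.re * t) ≤ 1`, the bound `a ‖u‖ ≤ a + ‖u‖²` has an integrable right side.
  have hui : ∀ s : ℂ, 0 < s.re →
      IntegrableOn (fun t : ℝ => Complex.exp (-s * t) • u t) (Set.Ioi 0) := by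
    intro s hs
    refine Integrable.mono' ((exp_neg_integrableOn_Ioi 0 hs).add hsq)
      (((hexp s).continuousOn.smul hu).mono Set.Ioi_subset_Ici_self |>.aestronglyMeasurable
        measurableSet_Ioi) ((ae_restrict_mem measurableSet_Ioi).mono fun t ht => ?_)
    rw [norm_smul, norm_cexp_neg_mul_ofReal]
    have h1 : Real.exp (-s.re * t) ≤ 1 :=
      Real.exp_le_one_iff.2 (by nlinarith [Set.mem_Ioi.1 ht])
    have h2 := Real.exp_pos (-s.re * t)
    change _ ≤ Real.exp (-s.re * t) + ‖u t‖ ^ 2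
    nlinarith [sq_nonneg (‖u t‖ - 1), norm_nonneg (u t)]
  -- Half of the decay rate `s.re` absorbs the growth of `x`; the other half remains for
  -- integrability.
  have hxb : ∀ s : ℂ, 0 < s.re → ∃ D, ∀ t : ℝ, 0 ≤ t →
      ‖Complex.exp (-s * t) • x t‖ ≤ D * Real.exp (-(s.re / 2) * t) := by
    intro s hs
    obtain ⟨D, hD⟩ := exists_norm_le_exp_of_hasDerivWithinAt_linear hC
      (B.continuous.comp_continuousOn hu) hBu2 hx0 hx (half_pos hs)
    refine ⟨D, fun t ht => ?_⟩
    rw [norm_smul, norm_cexp_neg_mul_ofReal]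
    calc _ ≤ Real.exp (-s.re * t) * (D * Real.exp (s.re / 2 * t)) := by gcongr; exact hD t ht
      _ = D * (Real.exp (-s.re * t) * Real.exp (s.re / 2 * t)) := by ring
      _ = _ := by rw [← Real.exp_add]; congr 2; ring
  have hxi : ∀ s : ℂ, 0 < s.re →
      IntegrableOn (fun t : ℝ => Complex.exp (-s * t) • x t) (Set.Ioi 0) := fun s hs =>
    integrableOn_Ioi_of_norm_le_exp ((hexp s).continuousOn.smul hxc) (half_pos hs) (hxb s hs).choose_spec
  have hgain : ∀ s : ℂ, 0 < s.re →
      ‖∫ t in Set.Ioi (0 : ℝ), Complex.exp (-s * t) • (G (x t) + H (u t))‖ ≤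
        α * ‖∫ t in Set.Ioi (0 : ℝ), Complex.exp (-s * t) • u t‖ := by
    intro s hs
    have hL := laplace_of_hasDerivWithinAt_linear hx0 hx (hxi s hs)
      (by simpa only [map_smul] using! B.integrable_comp (hui s hs))
      (tendsto_zero_of_norm_le_exp (half_pos hs) (hxb s hs).choose_spec)
    simp only [← map_smul B] at hL
    rw [B.integral_comp_comm (hui s hs)] at hL
    convert hα s hs _ _ hL using 2
    rw [← G.integral_comp_comm (hxi s hs), ← H.integral_comp_comm (hui s hs),
      ← integral_add (G.integrable_comp (hxi s hs)) (H.integrable_comp (hui s hs))]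
    simp only [map_smul, smul_add]
  have hweighted : ∀ σ : ℝ, 0 < σ →
      eLpNorm (fun t : ℝ => Complex.exp (-(σ : ℂ) * t) • (G (x t) + H (u t))) 2
        (volume.restrict (Set.Ici 0)) ≤
      ENNReal.ofReal α * eLpNorm u 2 (volume.restrict (Set.Ici 0)) := by
    intro σ hσ
    have hσ' : 0 < (σ : ℂ).re := hσ
    have hule : ∀ᵐ t : ℝ ∂(volume.restrict (Set.Ici (0 : ℝ))),
        ‖Complex.exp (-(σ : ℂ) * t) • u t‖ ≤ ‖u t‖ := by
      refine (ae_restrict_mem measurableSet_Ici).mono fun t ht => ?_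
      rw [norm_smul, norm_cexp_neg_mul_ofReal]
      refine mul_le_of_le_one_left (norm_nonneg _) (Real.exp_le_one_iff.2 ?_)
      rw [Complex.ofReal_re]
      nlinarith [Set.mem_Ici.1 ht]
    have hu2' : MemLp (fun t : ℝ => Complex.exp (-(σ : ℂ) * t) • u t) 2
        (volume.restrict (Set.Ici 0)) :=
      hu2.mono (((hexp σ).continuousOn.smul hu).aestronglyMeasurable measurableSet_Ici) hule
    have hx2' : MemLp (fun t : ℝ => Complex.exp (-(σ : ℂ) * t) • x t) 2
        (volume.restrict (Set.Ici 0)) :=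
      memLp_two_Ici_of_norm_le_exp ((hexp σ).continuousOn.smul hxc) (half_pos hσ')
        (hxb σ hσ').choose_spec
    have hy2' : MemLp (fun t : ℝ => Complex.exp (-(σ : ℂ) * t) • (G (x t) + H (u t))) 2
        (volume.restrict (Set.Ici 0)) := by
      refine ((G.comp_memLp' hx2').add (H.comp_memLp' hu2')).ae_eq (ae_of_all _ fun t => ?_)
      simp only [Pi.add_apply, Function.comp_apply, smul_add, map_smul]
    have hyi : IntegrableOn (fun t : ℝ => Complex.exp (-(σ : ℂ) * t) • (G (x t) + H (u t)))
        (Set.Ioi 0) := by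
      simpa only [smul_add, map_smul] using!
        (G.integrable_comp (hxi σ hσ')).add (H.integrable_comp (hui σ hσ'))
    refine (eLpNorm_le_of_norm_laplace_le hyi hy2' (hui σ hσ') hu2' fun ω =>
      hgain _ (by simpa using hσ)).trans ?_
    gcongr
    exact eLpNorm_mono_ae hule
  have hyc : ContinuousOn (fun t => G (x t) + H (u t)) (Set.Ici 0) :=
    (G.continuous.comp_continuousOn hxc).add (H.continuous.comp_continuousOn hu)
  -- Fatou's lemma along `σ = 1/(k+1) → 0`: the weighted bounds are uniform in `σ`, so the
  -- unweighted output need not be known to be square-integrable beforehand.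
  refine (Lp.eLpNorm_lim_le_liminf_eLpNorm
    (f := fun (k : ℕ) (t : ℝ) =>
      Complex.exp (-((1 / ((k : ℝ) + 1) : ℝ) : ℂ) * t) • (G (x t) + H (u t)))
    (fun k => ((hexp _).continuousOn.smul hyc).aestronglyMeasurable measurableSet_Ici) _
    (ae_of_all _ fun t => ?_)).trans ?_
  · have h1 : Filter.Tendsto (fun k : ℕ => Complex.exp (-((1 / ((k : ℝ) + 1) : ℝ) : ℂ) * t))
        Filter.atTop (nhds (Complex.exp (-((0 : ℝ) : ℂ) * t))) :=
      (Complex.continuous_exp.tendsto _).comp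
        (((Complex.continuous_ofReal.tendsto _).comp
          tendsto_one_div_add_atTop_nhds_zero_nat).neg.mul_const _)
    simpa using h1.smul_const (G (x t) + H (u t))
  · exact Filter.liminf_le_of_le (by isBoundedDefault) fun b hb =>
      hb.exists.elim fun k hk => hk.trans (hweighted _ Nat.one_div_pos_of_nat)

end HInfinity

/-- Integrating the derivative of `e^{-st} e^{tT} X` over `[0, ∞)` gives `X = ∫ e^{-st} e^{tT} w
dt`, and `C / c` is the integral of `C e^{-ct}`. Uniformity in `s` is what makes the `H∞`-norms
finite. -/
theorem norm_le_of_resolvent_eq {E : Type*} [NormedAddCommGroup E] [NormedSpace ℂ E]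
    [CompleteSpace E] {T : E →L[ℂ] E} {C c : ℝ} (hc : 0 < c)
    (hC : ∀ t : ℝ, 0 ≤ t → ‖NormedSpace.exp ((t : ℂ) • T)‖ ≤ C * Real.exp (-c * t))
    {s : ℂ} (hs : 0 < s.re) {X w : E} (h : s • X - T X = w) : ‖X‖ ≤ C / c * ‖w‖ := by
  have hS := T.hasDerivAt_exp_ofReal_smul
  have hSc : Continuous fun t : ℝ => NormedSpace.exp ((t : ℂ) • T) :=
    continuous_iff_continuousAt.2 fun t => (hS t).continuousAt
  have he : ∀ t : ℝ, HasDerivAt (fun t : ℝ => Complex.exp (-s * t))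
      (-s * Complex.exp (-s * t)) t := by
    intro t
    have := ((Complex.ofRealCLM.hasDerivAt (x := t)).const_mul (-s)).cexp
    simpa [mul_comm] using this
  have hec : Continuous fun t : ℝ => Complex.exp (-s * t) :=
    continuous_iff_continuousAt.2 fun t => (he t).continuousAt
  have hb : ∀ v : E, ∀ t : ℝ, 0 ≤ t →
      ‖Complex.exp (-s * t) • NormedSpace.exp ((t : ℂ) • T) v‖ ≤
        C * ‖v‖ * Real.exp (-c * t) := by
    intro v t ht
    rw [norm_smul, norm_cexp_neg_mul_ofReal]
    refine (mul_le_of_le_one_left (norm_nonneg _) (Real.exp_le_one_iff.2 (by nlinarith))).trans ?_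
    refine (ContinuousLinearMap.le_opNorm _ _).trans ?_
    rw [mul_right_comm]
    exact mul_le_mul_of_nonneg_right (hC t ht) (norm_nonneg v)
  have hcv : ∀ v : E, Continuous fun t : ℝ =>
      Complex.exp (-s * t) • NormedSpace.exp ((t : ℂ) • T) v := fun v =>
    hec.smul (hSc.clm_apply continuous_const)
  have hint := integral_Ioi_of_hasDerivAt_of_tendsto
    (f := fun t : ℝ => Complex.exp (-s * t) • NormedSpace.exp ((t : ℂ) • T) X) (a := 0)
    (f' := fun t : ℝ => -(Complex.exp (-s * t) • NormedSpace.exp ((t : ℂ) • T) w))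
    (hcv X).continuousWithinAt
    (fun t _ => by
      refine ((he t).smul ((hS t).complex_clm_apply (hasDerivAt_const t X))).congr_deriv ?_
      rw [← h]
      simp only [mul_apply_eq_comp, map_zero, add_zero, map_sub, map_smul, smul_sub, mul_smul,
        neg_smul, smul_comm s]
      abel)
    (integrableOn_Ioi_of_norm_le_exp (hcv w).continuousOn hc (hb w)).neg
    (tendsto_zero_of_norm_le_exp hc (hb X))
  have hX : ‖X‖ = ‖∫ t in Set.Ioi (0 : ℝ),
      -(Complex.exp (-s * t) • NormedSpace.exp ((t : ℂ) • T) w)‖ := by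
    rw [hint]; simp
  rw [hX]
  refine (norm_integral_le_of_norm_le ((exp_neg_integrableOn_Ioi 0 hc).const_mul (C * ‖w‖))
    ((ae_restrict_mem measurableSet_Ioi).mono fun t ht => ?_)).trans_eq ?_
  · rw [norm_neg]
    exact hb w t (le_of_lt ht)
  · rw [integral_const_mul, integral_exp_mul_Ioi (neg_lt_zero.2 hc)]
    simp
    field_simp

/-! ### Passage from real to complex vectors and matrices -/

section Complexification

variable {k m n : Type*} [Fintype n]

theorem matAct_smul (M : Matrix m n ℝ) (c : ℝ) (v : EuclideanSpace ℝ n) :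
    matAct M (c • v) = c • matAct M v := by
  ext i; simp [matAct, mulVec_smul]

theorem matAct_mul [Fintype m] (M : Matrix k m ℝ) (N : Matrix m n ℝ) (v : EuclideanSpace ℝ n) :
    matAct (M * N) v = matAct M (matAct N v) := by
  ext i; simp [matAct, mulVec_mulVec]

/-- The complexification of a real Euclidean vector. -/
noncomputable def complexVec (n : Type*) [Fintype n] :
    EuclideanSpace ℝ n →L[ℝ] EuclideanSpace ℂ n :=
  LinearMap.toContinuousLinearMap
    { toFun := fun v => WithLp.toLp 2 fun i => (v i : ℂ)
      map_add' := fun v w => by ext i; simp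
      map_smul' := fun c v => by ext i; simp }

@[simp] theorem complexVec_apply (v : EuclideanSpace ℝ n) (i : n) :
    complexVec n v i = (v i : ℂ) := rfl

theorem norm_complexVec (v : EuclideanSpace ℝ n) : ‖complexVec n v‖ = ‖v‖ := by
  simp [EuclideanSpace.norm_eq]

/-- The continuous linear map given by a complex matrix. -/
noncomputable def matCLM [Fintype m] [DecidableEq n] (M : Matrix m n ℂ) :
    EuclideanSpace ℂ n →L[ℂ] EuclideanSpace ℂ m :=
  LinearMap.toContinuousLinearMap (Matrix.toEuclideanLin M)

theorem matCLM_apply [Fintype m] [DecidableEq n] (M : Matrix m n ℂ) (v : EuclideanSpace ℂ n) :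
    matCLM M v = WithLp.toLp 2 (M *ᵥ WithLp.ofLp v) := rfl

theorem complexVec_matAct [Fintype m] [DecidableEq n] (M : Matrix m n ℝ) (v : EuclideanSpace ℝ n) :
    complexVec m (matAct M v) = matCLM (M.map Complex.ofReal) (complexVec n v) := by
  ext i
  simp [matCLM_apply, matAct, mulVec, dotProduct]

theorem matCLM_mul_apply [Fintype k] [Fintype m] [DecidableEq m] [DecidableEq n]
    (M : Matrix k m ℂ) (N : Matrix m n ℂ) (v : EuclideanSpace ℂ n) :
    matCLM (M * N) v = matCLM M (matCLM N v) := by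
  simp [matCLM_apply, mulVec_mulVec]

theorem spectrum_matCLM [DecidableEq n] (M : Matrix n n ℂ) : spectrum ℂ (matCLM M) = spectrum ℂ M :=
  AlgEquiv.spectrum_eq (Matrix.toEuclideanCLM (𝕜 := ℂ) (n := n)).toAlgEquiv M

open scoped Matrix.Norms.L2Operator in
-- Complexifying a matrix and letting it act is a continuous ring homomorphism, hence commutes with
-- the exponential series.
theorem matCLM_exp [DecidableEq n] (A : Matrix n n ℝ) (t : ℝ) :
    matCLM ((NormedSpace.exp (t • A)).map Complex.ofReal) =
      NormedSpace.exp ((t : ℂ) • matCLM (A.map Complex.ofReal)) := by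
  let _ : NormedAlgebra ℚ (Matrix n n ℝ) := NormedAlgebra.restrictScalars ℚ ℝ _
  let φ : Matrix n n ℝ →+* (EuclideanSpace ℂ n →L[ℂ] EuclideanSpace ℂ n) :=
    ((Matrix.toEuclideanCLM (𝕜 := ℂ) (n := n)) : _ →+* _).comp (Complex.ofRealHom.mapMatrix)
  have hφ : Continuous φ := by
    have h : Continuous (Matrix.toEuclideanCLM (𝕜 := ℂ) (n := n)) :=
      LinearMap.continuous_of_finiteDimensional
        ((Matrix.toEuclideanCLM (𝕜 := ℂ) (n := n)).toAlgEquiv.toLinearMap)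
    exact h.comp (continuous_id.matrix_map Complex.continuous_ofReal)
  have h := NormedSpace.map_exp φ hφ (t • A)
  have h2 : φ (t • A) = (t : ℂ) • matCLM (A.map Complex.ofReal) := by
    change matCLM ((t • A).map Complex.ofReal) = _
    ext v i
    simp [matCLM_apply, mulVec, dotProduct, Finset.mul_sum, mul_assoc]
  rw [← h2, ← h]
  rfl

end Complexification

/-! ### Stable state-space systems: transfer matrix, free response, gain -/

section StableSystem

variable {n u y : Type*} [Fintype n] [Fintype u] [Fintype y] [DecidableEq n]

theorem IsStableMatrix.exists_norm_exp_le {A : Matrix n n ℝ} (hA : IsStableMatrix A) :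
    ∃ C c : ℝ, 0 < C ∧ 0 < c ∧ ∀ t : ℝ, 0 ≤ t →
      ‖NormedSpace.exp ((t : ℂ) • matCLM (A.map Complex.ofReal))‖ ≤ C * Real.exp (-c * t) :=
  ContinuousLinearMap.exists_norm_exp_le fun μ hμ => hA μ (by rwa [spectrum_matCLM] at hμ)

theorem matCLM_smul_one_sub_apply (M : Matrix n n ℂ) (s : ℂ) (v : EuclideanSpace ℂ n) :
    matCLM (s • 1 - M) v = s • v - matCLM M v := by
  ext i
  simp [matCLM_apply, sub_mulVec, smul_mulVec]

theorem matCLM_add_apply [DecidableEq u] (M N : Matrix y u ℂ)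
    (v : EuclideanSpace ℂ u) : matCLM (M + N) v = matCLM M v + matCLM N v := by
  ext i
  simp [matCLM_apply, add_mulVec]

theorem IsStableMatrix.isUnit_det {A : Matrix n n ℝ} (hA : IsStableMatrix A) {s : ℂ}
    (hs : 0 < s.re) : IsUnit (s • (1 : Matrix n n ℂ) - A.map Complex.ofReal).det := by
  rw [← Matrix.isUnit_iff_isUnit_det]
  by_contra h
  refine (hA s ?_).not_gt hs
  rwa [spectrum.mem_iff, Algebra.algebraMap_eq_smul_one]

/-- The transfer function `P (sI - A)⁻¹ Q + D` of a linear system. -/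
noncomputable def transferMatrix (A : Matrix n n ℝ) (Q : Matrix n u ℝ) (P : Matrix y n ℝ)
    (D : Matrix y u ℝ) (s : ℂ) : Matrix y u ℂ :=
  P.map Complex.ofReal * ((s • (1 : Matrix n n ℂ) - A.map Complex.ofReal)⁻¹ *
    Q.map Complex.ofReal) + D.map Complex.ofReal

/-- Translates between the inverse in the transfer matrix and the inverse-free resolvent equation on
which the analytic estimates are stated. -/
theorem matCLM_transferMatrix_apply [DecidableEq u] {A : Matrix n n ℝ} (hA : IsStableMatrix A)
    (Q : Matrix n u ℝ) (P : Matrix y n ℝ) (D : Matrix y u ℝ) {s : ℂ} (hs : 0 < s.re)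
    {X : EuclideanSpace ℂ n} {V : EuclideanSpace ℂ u}
    (h : s • X - matCLM (A.map Complex.ofReal) X = matCLM (Q.map Complex.ofReal) V) :
    matCLM (transferMatrix A Q P D s) V =
      matCLM (P.map Complex.ofReal) X + matCLM (D.map Complex.ofReal) V := by
  rw [transferMatrix, matCLM_add_apply, matCLM_mul_apply, matCLM_mul_apply, ← h,
    ← matCLM_smul_one_sub_apply, ← matCLM_mul_apply (_ : Matrix n n ℂ)⁻¹,
    Matrix.nonsing_inv_mul _ (hA.isUnit_det hs)]
  simp [matCLM_apply]

theorem exists_resolvent_eq [DecidableEq u] {A : Matrix n n ℝ} (hA : IsStableMatrix A)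
    (Q : Matrix n u ℝ) {s : ℂ} (hs : 0 < s.re) (V : EuclideanSpace ℂ u) :
    ∃ X : EuclideanSpace ℂ n,
      s • X - matCLM (A.map Complex.ofReal) X = matCLM (Q.map Complex.ofReal) V := by
  refine ⟨matCLM ((s • (1 : Matrix n n ℂ) - A.map Complex.ofReal)⁻¹)
    (matCLM (Q.map Complex.ofReal) V), ?_⟩
  rw [← matCLM_smul_one_sub_apply, ← matCLM_mul_apply,
    Matrix.mul_nonsing_inv _ (hA.isUnit_det hs)]
  simp [matCLM_apply]

theorem hInfNorm_transferMatrix_lt_top [DecidableEq u] {A : Matrix n n ℝ} (hA : IsStableMatrix A)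
    (Q : Matrix n u ℝ) (P : Matrix y n ℝ) (D : Matrix y u ℝ) :
    hInfNorm (transferMatrix A Q P D) < ⊤ := by
  obtain ⟨C, c, hC0, hc, hC⟩ := hA.exists_norm_exp_le
  set p := ‖matCLM (P.map Complex.ofReal)‖
  set q := ‖matCLM (Q.map Complex.ofReal)‖
  set d := ‖matCLM (D.map Complex.ofReal)‖
  refine lt_of_le_of_lt (iSup₂_le fun s hs => ?_)
    (ENNReal.ofReal_lt_top (r := p * (C / c * q) + d))
  rw [← ofReal_norm]
  refine ENNReal.ofReal_le_ofReal (ContinuousLinearMap.opNorm_le_bound _ (by positivity)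
    fun V => ?_)
  obtain ⟨X, hX⟩ := exists_resolvent_eq hA Q hs V
  change ‖matCLM (transferMatrix A Q P D s) V‖ ≤ _
  rw [matCLM_transferMatrix_apply hA Q P D hs hX]
  have h1 : ‖X‖ ≤ C / c * (q * ‖V‖) := (norm_le_of_resolvent_eq hc hC hs hX).trans
    (by gcongr; exact ContinuousLinearMap.le_opNorm _ _)
  calc _ ≤ p * ‖X‖ + d * ‖V‖ := norm_add_le_of_le (ContinuousLinearMap.le_opNorm _ _)
        (ContinuousLinearMap.le_opNorm _ _)
    _ ≤ p * (C / c * (q * ‖V‖)) + d * ‖V‖ := by gcongr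
    _ = _ := by ring

theorem complexVec_matAct_exp (A : Matrix n n ℝ) (t : ℝ) (v : EuclideanSpace ℝ n) :
    complexVec n (matAct (NormedSpace.exp (t • A)) v) =
      NormedSpace.exp ((t : ℂ) • matCLM (A.map Complex.ofReal)) (complexVec n v) := by
  rw [complexVec_matAct, matCLM_exp]

omit [DecidableEq n] in
theorem l2Norm_eq_complexVec (f : ℝ → EuclideanSpace ℝ n) :
    l2Norm f = eLpNorm (fun t => complexVec n (f t)) 2 (volume.restrict (Set.Ici 0)) :=
  eLpNorm_congr_norm_ae (Filter.Eventually.of_forall fun _ => (norm_complexVec _).symm)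

theorem memLp_freeResponse {A : Matrix n n ℝ} (hA : IsStableMatrix A) (P : Matrix y n ℝ)
    (v : EuclideanSpace ℝ n) :
    MemLp (fun t : ℝ => complexVec y (matAct (P * NormedSpace.exp (t • A)) v)) 2
      (volume.restrict (Set.Ici 0)) := by
  obtain ⟨C, c, hC0, hc, hC⟩ := hA.exists_norm_exp_le
  simp only [matAct_mul, complexVec_matAct P, complexVec_matAct_exp]
  refine (matCLM (P.map Complex.ofReal)).comp_memLp' (memLp_two_Ici_of_norm_le_exp
    (D := C * ‖complexVec n v‖) ?_ hc fun t ht => ?_)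
  · exact (continuous_iff_continuousAt.2 fun t =>
      (((matCLM (A.map Complex.ofReal)).hasDerivAt_exp_ofReal_smul t).complex_clm_apply
        (hasDerivAt_const t _)).continuousAt).continuousOn
  · rw [mul_right_comm]
    exact (ContinuousLinearMap.le_opNorm _ _).trans
      (mul_le_mul_of_nonneg_right (hC t ht) (norm_nonneg _))

/-- Superposition: subtracting `e^{tA} x(0)` leaves a trajectory `z` that starts at rest, to which
the `H∞` gain bound applies; the triangle inequality restores the free response. -/
theorem l2Norm_output_le [DecidableEq u] {A : Matrix n n ℝ} (hA : IsStableMatrix A)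
    {Q : Matrix n u ℝ} {P : Matrix y n ℝ} {D : Matrix y u ℝ} {v : ℝ → EuclideanSpace ℝ u}
    {x : ℝ → EuclideanSpace ℝ n} (hv : ContinuousOn v (Set.Ici 0)) (hv2 : l2Norm v < ⊤)
    (hx : (StateSpace.mk A Q P).IsTrajectory v x) :
    l2Norm (fun t => matAct P (x t) + matAct D (v t)) ≤
      hInfNorm (transferMatrix A Q P D) * l2Norm v +
        l2Norm (fun t => matAct (P * NormedSpace.exp (t • A)) (x 0)) := by
  obtain ⟨C, c, hC0, hc, hC⟩ := hA.exists_norm_exp_le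
  have htop := hInfNorm_transferMatrix_lt_top hA Q P D
  set T := matCLM (A.map Complex.ofReal) with hT
  let S : ℝ → EuclideanSpace ℂ n := fun t => NormedSpace.exp ((t : ℂ) • T) (complexVec n (x 0))
  have hS : ∀ t, HasDerivAt S (T (S t)) t := fun t => by
    have h := (T.hasDerivAt_exp_ofReal_smul t).complex_clm_apply
      (hasDerivAt_const t (complexVec n (x 0)))
    have hcomm : Commute (NormedSpace.exp ((t : ℂ) • T)) T :=
      ((Commute.refl T).smul_left _).exp_left
    rwa [map_zero, add_zero, hcomm.eq] at h
  let z : ℝ → EuclideanSpace ℂ n := fun t => complexVec n (x t) - S t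
  have hvc : ContinuousOn (fun t => complexVec u (v t)) (Set.Ici 0) :=
    (complexVec u).continuous.comp_continuousOn hv
  have hz : ∀ t, 0 ≤ t → HasDerivWithinAt z
      (T (z t) + matCLM (Q.map Complex.ofReal) (complexVec u (v t))) (Set.Ici 0) t := by
    intro t ht
    refine (((complexVec n).hasFDerivAt.comp_hasDerivWithinAt t (hx t ht)).sub
      (hS t).hasDerivWithinAt).congr_deriv ?_
    simp only [map_add, complexVec_matAct, z, map_sub, ← hT]
    abel
  have hz0 : z 0 = 0 := by
    have h : NormedSpace.exp (((0 : ℝ) : ℂ) • T) = 1 := by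
      rw [Complex.ofReal_zero, zero_smul ℂ T, NormedSpace.exp_zero]
    simp only [z, S, h, one_apply_eq_self, sub_self]
  have hzc : ContinuousOn z (Set.Ici 0) := fun t ht => (hz t ht).continuousWithinAt
  have hv2c : MemLp (fun t => complexVec u (v t)) 2 (volume.restrict (Set.Ici 0)) :=
    ⟨hvc.aestronglyMeasurable measurableSet_Ici, by rwa [← l2Norm_eq_complexVec]⟩
  have hC' : ∀ t : ℝ, 0 ≤ t → ‖NormedSpace.exp ((t : ℂ) • T)‖ ≤ C := fun t ht =>
    (hC t ht).trans (mul_le_of_le_one_right hC0.le (Real.exp_le_one_iff.2 (by nlinarith)))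
  have hgain := eLpNorm_output_le (G := matCLM (P.map Complex.ofReal))
    (H := matCLM (D.map Complex.ofReal)) (α := (hInfNorm (transferMatrix A Q P D)).toReal) hC'
    (fun s hs X V h => by
      rw [← matCLM_transferMatrix_apply hA Q P D hs h]
      refine (ContinuousLinearMap.le_opNorm _ _).trans
        (mul_le_mul_of_nonneg_right ?_ (norm_nonneg V))
      rw [← toReal_enorm]
      exact ENNReal.toReal_mono htop.ne (le_iSup₂ (f := fun (s : ℂ) (_ : 0 < s.re) =>
        ‖matCLM (transferMatrix A Q P D s)‖ₑ) s hs))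
    hvc hv2c hz0 hz
  rw [ENNReal.ofReal_toReal htop.ne, ← l2Norm_eq_complexVec] at hgain
  rw [l2Norm_eq_complexVec, l2Norm_eq_complexVec (n := y)]
  refine le_trans (le_of_eq (congrArg (fun f => eLpNorm f 2 _) ?_))
    ((eLpNorm_add_le (ContinuousOn.aestronglyMeasurable
      (((matCLM (P.map Complex.ofReal)).continuous.comp_continuousOn hzc).add
        ((matCLM (D.map Complex.ofReal)).continuous.comp_continuousOn hvc)) measurableSet_Ici)
      (memLp_freeResponse hA P (x 0)).aestronglyMeasurable one_le_two).trans
      (add_le_add_left hgain _))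
  funext t
  simp only [Pi.add_apply, Function.comp_apply, map_add, complexVec_matAct, matAct_mul,
    matCLM_exp, z, map_sub, S, ← hT]
  abel

end StableSystem

/-! ### Block-triangular stability and stacked signals -/

theorem isStableMatrix_fromBlocks_zero₁₂ {m n : Type*} [Fintype m] [Fintype n] [DecidableEq m]
    [DecidableEq n] (M₁₁ : Matrix m m ℝ) (M₂₁ : Matrix n m ℝ) (M₂₂ : Matrix n n ℝ) :
    IsStableMatrix (fromBlocks M₁₁ 0 M₂₁ M₂₂) ↔ IsStableMatrix M₁₁ ∧ IsStableMatrix M₂₂ := by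
  have h : ∀ μ : ℂ, μ ∈ spectrum ℂ ((fromBlocks M₁₁ 0 M₂₁ M₂₂).map Complex.ofReal) ↔
      μ ∈ spectrum ℂ (M₁₁.map Complex.ofReal) ∨ μ ∈ spectrum ℂ (M₂₂.map Complex.ofReal) := by
    intro μ
    have h0 : (0 : Matrix m n ℝ).map Complex.ofReal = 0 := by ext; simp
    rw [fromBlocks_map, h0]
    simp only [Matrix.mem_spectrum_iff_isRoot_charpoly, charpoly_fromBlocks_zero₁₂,
      Polynomial.root_mul]
  simp only [IsStableMatrix, h, or_imp, forall_and]

theorem hasDerivWithinAt_euclidean {n : Type*} [Fintype n] {f : ℝ → EuclideanSpace ℝ n}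
    {f' : EuclideanSpace ℝ n} {s : Set ℝ} {t : ℝ} :
    HasDerivWithinAt f f' s t ↔ ∀ i, HasDerivWithinAt (fun t => f t i) (f' i) s t := by
  simp only [hasDerivWithinAt_iff_hasFDerivWithinAt]
  rw [hasFDerivWithinAt_euclidean]
  refine forall_congr' fun i => iff_of_eq (congrArg (HasFDerivWithinAt _ · s t) ?_)
  ext
  simp

theorem hasDerivWithinAt_stack {m n : Type*} [Fintype m] [Fintype n]
    {x : ℝ → EuclideanSpace ℝ m} {y : ℝ → EuclideanSpace ℝ n} {x' : EuclideanSpace ℝ m}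
    {y' : EuclideanSpace ℝ n} {s : Set ℝ} {t : ℝ} :
    HasDerivWithinAt (fun t => stack (x t) (y t)) (stack x' y') s t ↔
      HasDerivWithinAt x x' s t ∧ HasDerivWithinAt y y' s t := by
  simp only [hasDerivWithinAt_euclidean, Sum.forall]
  rfl

/-! ### The hierarchical realization as a cascade -/

namespace InterconnectedSystem

variable {n₁ n₂ m p q r : ℕ} (S : InterconnectedSystem n₁ n₂ m p q r)

theorem closedLoopMatrix_hierarchical (K₁ : Matrix (Fin m) (Fin p) ℝ) :
    S.hierarchical.closedLoopMatrix K₁ =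
      fromBlocks (S.A₁ + S.B₁ * K₁ * S.C₁) 0 (fromRows 0 (S.L₂ * S.Γ₁)) S.A := by
  ext i j
  rcases i with i | i <;> rcases j with j | j <;>
    simp [StateSpace.closedLoopMatrix, hierarchical, fromRows_mul, mul_fromCols,
      Matrix.mul_assoc]

theorem E₁_map : (E₁ ℝ n₁ n₂).map Complex.ofReal = E₁ ℂ n₁ n₂ := by
  ext (i | i) j <;> simp [E₁, Matrix.one_apply, apply_ite]

theorem E₂_map : (E₂ ℝ n₁ n₂).map Complex.ofReal = E₂ ℂ n₁ n₂ := by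
  ext (i | i) j <;> simp [E₂, Matrix.one_apply, apply_ite]

theorem E₂_mul_map {k : ℕ} (M : Matrix (Fin n₂) (Fin k) ℝ) :
    (E₂ ℝ n₁ n₂ * M).map Complex.ofReal = E₂ ℂ n₁ n₂ * M.map Complex.ofReal := by
  rw [← E₂_map]
  exact Matrix.map_mul (f := Complex.ofRealHom)

/-- The feedthrough `1` is the direct contribution of the input `ξ̂₁` to the output `ξ₁ + ξ̂₁`. -/
theorem G₁_add_one :
    (fun s => S.G₁ s + 1) = transferMatrix S.A (E₂ ℝ n₁ n₂ * (S.L₂ * S.Γ₁)) (E₁ ℝ n₁ n₂)ᵀ 1 := by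
  funext s
  simp [G₁, transfer, transferMatrix, E₁_map, transpose_map, E₂_mul_map, Matrix.mul_assoc]

theorem G₂_eq :
    S.G₂ = transferMatrix S.A (E₂ ℝ n₁ n₂ * (S.L₂ * S.Γ₁)) (E₂ ℝ n₁ n₂)ᵀ 0 := by
  funext s
  simp [G₂, transfer, transferMatrix, E₂_map, transpose_map, E₂_mul_map, Matrix.mul_assoc]

theorem matAct_E₁ (ζ : EuclideanSpace ℝ (Fin n₁)) : matAct (E₁ ℝ n₁ n₂) ζ = stack ζ 0 := by
  ext (i | i) <;> simp [matAct, stack, E₁, fromRows_mulVec]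

theorem matAct_E₁_transpose_stack (x : EuclideanSpace ℝ (Fin n₁)) (y : EuclideanSpace ℝ (Fin n₂)) :
    matAct (E₁ ℝ n₁ n₂)ᵀ (stack x y) = x := by
  ext i; simp [matAct, stack, E₁, transpose_fromRows, fromCols_mulVec]

theorem matAct_E₂_transpose_stack (x : EuclideanSpace ℝ (Fin n₁)) (y : EuclideanSpace ℝ (Fin n₂)) :
    matAct (E₂ ℝ n₁ n₂)ᵀ (stack x y) = y := by
  ext i; simp [matAct, stack, E₂, transpose_fromRows, fromCols_mulVec]

theorem hierarchical_vectorField (K₁ : Matrix (Fin m) (Fin p) ℝ)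
    (x : EuclideanSpace ℝ (Fin n₁)) (ξ : EuclideanSpace ℝ (Fin n₁ ⊕ Fin n₂)) :
    matAct S.hierarchical.A (stack x ξ) +
        matAct S.hierarchical.B (matAct K₁ (matAct S.hierarchical.C (stack x ξ))) =
      stack (matAct S.A₁ x + matAct S.B₁ (matAct K₁ (matAct S.C₁ x)))
        (matAct S.A ξ + matAct (E₂ ℝ n₁ n₂ * (S.L₂ * S.Γ₁)) x) := by
  ext i
  rcases i with i | i
  · simp [hierarchical, matAct, stack, fromBlocks_mulVec, fromRows_mulVec, fromCols_mulVec]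
  · simp [hierarchical, matAct, stack, fromBlocks_mulVec, fromRows_mulVec, fromCols_mulVec, E₂,
      fromRows_mul, add_comm]

variable {S}

/-- The output matrix `P` is arbitrary because trajectories ignore it; it is chosen later as `E₁ᵀ`
or `E₂ᵀ`. -/
theorem closedLoop_hierarchical {y : Type*} {P : Matrix y (Fin n₁ ⊕ Fin n₂) ℝ}
    {K₁ : Matrix (Fin m) (Fin p) ℝ}
    {ξh : ℝ → EuclideanSpace ℝ (Fin n₁)} {ξ : ℝ → EuclideanSpace ℝ (Fin n₁ ⊕ Fin n₂)}
    (h : S.hierarchical.IsClosedLoopTrajectory K₁ fun t => stack (ξh t) (ξ t)) :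
    S.upstream.IsClosedLoopTrajectory K₁ ξh ∧
      (StateSpace.mk S.A (E₂ ℝ n₁ n₂ * (S.L₂ * S.Γ₁)) P).IsTrajectory ξh ξ := by
  have key : ∀ t, 0 ≤ t → HasDerivWithinAt ξh _ (Set.Ici 0) t ∧
      HasDerivWithinAt ξ _ (Set.Ici 0) t := fun t ht =>
    hasDerivWithinAt_stack.1 ((h t ht).congr_deriv (S.hierarchical_vectorField K₁ (ξh t) (ξ t)))
  exact ⟨fun t ht => (key t ht).1, fun t ht => (key t ht).2⟩

/-- The isolated loop is linear, so dividing a trajectory by `c` brings its initial value into the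
unit ball. -/
theorem LocalSpec.l2Norm_le {K₁ : Matrix (Fin m) (Fin p) ℝ} {ε₁ : ℝ} (h : S.LocalSpec K₁ ε₁)
    {ξh : ℝ → EuclideanSpace ℝ (Fin n₁)} (hξ : S.upstream.IsClosedLoopTrajectory K₁ ξh) {c : ℝ}
    (hc : 0 < c) (h0 : ‖ξh 0‖ ≤ c) :
    l2Norm ξh ≤ ENNReal.ofReal c * ENNReal.ofReal ε₁ := by
  have h1 : l2Norm (fun t => c⁻¹ • ξh t) ≤ ENNReal.ofReal ε₁ := by
    refine h _ (fun t ht => ?_) ?_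
    · refine ((hξ t ht).const_smul c⁻¹).congr_deriv ?_
      simp only [matAct_smul, smul_add]
    · rw [norm_smul, Real.norm_of_nonneg (inv_pos.2 hc).le, ← div_eq_inv_mul]
      exact div_le_one_of_le₀ h0 hc.le
  calc l2Norm ξh = l2Norm (fun t => c • c⁻¹ • ξh t) := by simp [smul_smul, hc.ne']
    _ = ENNReal.ofReal c * l2Norm (fun t => c⁻¹ • ξh t) := by
        rw [← Real.enorm_of_nonneg hc.le]
        exact eLpNorm_const_smul c (fun t => c⁻¹ • ξh t) 2 (volume.restrict (Set.Ici 0))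
    _ ≤ _ := by gcongr

end InterconnectedSystem

/-! ### The main theorem -/

theorem lemma2 {n₁ n₂ m p q r : ℕ} (S : InterconnectedSystem n₁ n₂ m p q r)
    (hA : IsStableMatrix S.A) :
    (∀ K₁ : Matrix (Fin m) (Fin p) ℝ,
      IsStableMatrix (S.hierarchical.closedLoopMatrix K₁) ↔
        IsStableMatrix (S.A₁ + S.B₁ * K₁ * S.C₁)) ∧
    (S.α₁ < ⊤ ∧ S.α₂ < ⊤ ∧
      ∀ ζ₀ : EuclideanSpace ℝ (Fin n₁), S.β₁ ζ₀ < ⊤ ∧ S.β₂ ζ₀ < ⊤) ∧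
    (∀ (K₁ : Matrix (Fin m) (Fin p) ℝ) (ε₁ : ℝ), 0 < ε₁ → S.LocalSpec K₁ ε₁ →
      ∀ ζ₀ δ₀ : EuclideanSpace ℝ (Fin n₁), ‖δ₀‖ ≤ 1 →
      ∀ (ξh ξ₁ : ℝ → EuclideanSpace ℝ (Fin n₁)) (ξ₂ : ℝ → EuclideanSpace ℝ (Fin n₂)),
        S.hierarchical.IsClosedLoopTrajectory K₁
          (fun t => stack (ξh t) (stack (ξ₁ t) (ξ₂ t))) →
        ξh 0 = δ₀ - ζ₀ → ξ₁ 0 = ζ₀ → ξ₂ 0 = 0 →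
        l2Norm (fun t => ξ₁ t + ξh t) ≤
            S.α₁ * ENNReal.ofReal (1 + ‖ζ₀‖) * ENNReal.ofReal ε₁ + S.β₁ ζ₀ ∧
        l2Norm ξ₂ ≤
            S.α₂ * ENNReal.ofReal (1 + ‖ζ₀‖) * ENNReal.ofReal ε₁ + S.β₂ ζ₀) := by
  have hβ : ∀ (k : ℕ) (P : Matrix (Fin k) (Fin n₁ ⊕ Fin n₂) ℝ) (ζ₀ : EuclideanSpace ℝ (Fin n₁)),
      l2Norm (fun t => matAct (P * NormedSpace.exp (t • S.A) *
        InterconnectedSystem.E₁ ℝ n₁ n₂) ζ₀) < ⊤ := by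
    intro k P ζ₀
    simp only [matAct_mul _ (InterconnectedSystem.E₁ ℝ n₁ n₂)]
    rw [l2Norm_eq_complexVec]
    exact (memLp_freeResponse hA P _).2
  refine ⟨fun K₁ => ?_, ⟨?_, ?_, fun ζ₀ => ⟨hβ _ _ ζ₀, hβ _ _ ζ₀⟩⟩, ?_⟩
  · rw [S.closedLoopMatrix_hierarchical, isStableMatrix_fromBlocks_zero₁₂]
    exact and_iff_left hA
  · rw [InterconnectedSystem.α₁, S.G₁_add_one]
    exact hInfNorm_transferMatrix_lt_top hA _ _ _
  · rw [InterconnectedSystem.α₂, S.G₂_eq]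
    exact hInfNorm_transferMatrix_lt_top hA _ _ _
  · intro K₁ ε₁ hε hspec ζ₀ δ₀ hδ ξh ξ₁ ξ₂ htraj h0 h1 h2
    obtain ⟨hup, hdown⟩ := InterconnectedSystem.closedLoop_hierarchical htraj
    have hl2 := hspec.l2Norm_le hup (c := 1 + ‖ζ₀‖) (by positivity)
      (by rw [h0]; exact (norm_sub_le _ _).trans (by gcongr))
    -- Square-integrability of `ξ̂₁` comes from the specification alone; stability of the isolated
    -- loop is not assumed.
    have htop : l2Norm ξh < ⊤ := hl2.trans_lt
      (ENNReal.mul_lt_top ENNReal.ofReal_lt_top ENNReal.ofReal_lt_top)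
    have hcont : ContinuousOn ξh (Set.Ici 0) := fun t ht => (hup t ht).continuousWithinAt
    have hx0 : stack (ξ₁ 0) (ξ₂ 0) = matAct (InterconnectedSystem.E₁ ℝ n₁ n₂) ζ₀ := by
      rw [h1, h2, InterconnectedSystem.matAct_E₁]
    have hone : ∀ v : EuclideanSpace ℝ (Fin n₁),
        matAct (1 : Matrix (Fin n₁) (Fin n₁) ℝ) v = v := fun v => by
      ext i; simp [matAct]
    have hzero : ∀ v : EuclideanSpace ℝ (Fin n₁),
        matAct (0 : Matrix (Fin n₂) (Fin n₁) ℝ) v = 0 := fun v => by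
      ext i; simp [matAct]
    constructor
    · have h := l2Norm_output_le (P := (InterconnectedSystem.E₁ ℝ n₁ n₂)ᵀ) (D := 1) hA hcont htop
        hdown
      simp only [InterconnectedSystem.matAct_E₁_transpose_stack, hx0, ← matAct_mul, hone,
        ← S.G₁_add_one] at h
      refine h.trans ?_
      rw [mul_assoc]
      exact add_le_add_left (mul_le_mul_right hl2 _) _
    · have h := l2Norm_output_le (P := (InterconnectedSystem.E₂ ℝ n₁ n₂)ᵀ) (D := 0) hA hcont htop
        hdown
      simp only [InterconnectedSystem.matAct_E₂_transpose_stack, hx0, ← matAct_mul, hzero,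
        add_zero, ← S.G₂_eq] at h
      refine h.trans ?_
      rw [mul_assoc]
      exact add_le_add_left (mul_le_mul_right hl2 _) _
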